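/- Let $\mu$ be a finite Borel measure on $\mathbb{C}$ whose support is bounded and infinite. Let $\{\varphi_n\}_{n\ge 0}$ be its orthonormal polynomials, obtained by Gram–Schmidt orthogonalization of $1,z,z^2,\dots$ in $L^2(\mu)$, with $\varphi_n$ of degree $n$ and leading coefficient $\kappa_n>0$, and let $$M_{j,k}=\int_{\mathbb{C}}\overline{\varphi_{j-1}(z)}\,z\,\varphi_{k-1}(z)\,d\mu(z),\qquad j,k\ge 1 .$$ Assume that there are $R>0$ and a function $f$, analytic in $\{z:R<|z|\le\infty\}$, such that $$\lim_{n\to\infty}\frac{\varphi_n(z)}{\varphi_{n+1}(z)}=f(z),\qquad R<|z|\le\infty,$$ and that $\liminf_{n\to\infty}\kappa_n/\kappa_{n+1}>0$. Then near infinity $1/f$ has an inverse function with a Laurent expansion of the form below: there is a function $g$ satisfying, for all $z$ of sufficiently large modulus, $$\frac{1}{f(g(z))}=z=g\left(\frac{1}{f(z)}\right),\qquad g(z)=\beta_{-1}z+\beta_0+\frac{\beta_1}{z}+\frac{\beta_2}{z^2}+\cdots .$$ Moreover, for any such $g$, with Laurent coefficients $\beta_{-1},\beta_0,\beta_1,\dots$,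 $$\lim_{n\to\infty}M_{n-j,n}=\beta_j\qquad\text{for every integer } j\ge -1 .$$ -/

import Mathlib

open MeasureTheory Filter Topology Polynomial
open scoped ComplexConjugate

noncomputable section

/-- The sesquilinear form of `L²(μ)` on polynomials, `∫ conj (p z) * q z dμ(z)`. -/
def polyInner (μ : Measure ℂ) (p q : ℂ[X]) : ℂ :=
  ∫ z, conj (p.eval z) * q.eval z ∂μ

/-- The monic orthogonal polynomials `Φ_n` of `μ`: Gram-Schmidt orthogonalization of
`1, z, z², …` in `L²(μ)`. -/
def monicOrthoPoly (μ : Measure ℂ) : ℕ → ℂ[X]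
  | n => X ^ n - ∑ k : Fin n,
      C (polyInner μ (monicOrthoPoly μ k) (X ^ n) /
        polyInner μ (monicOrthoPoly μ k) (monicOrthoPoly μ k)) * monicOrthoPoly μ k
termination_by n => n
decreasing_by all_goals exact k.2

/-- The orthonormal polynomials `φ_n = Φ_n / ‖Φ_n‖_{L²(μ)}`. -/
def orthoPoly (μ : Measure ℂ) (n : ℕ) : ℂ[X] :=
  C (((√(∫ z, ‖(monicOrthoPoly μ n).eval z‖ ^ 2 ∂μ))⁻¹ : ℝ) : ℂ) * monicOrthoPoly μ n

/-- The leading coefficient `κ_n` of `φ_n`; it is a positive real number when the support of `μ`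
is infinite and bounded. -/
def orthoLeadingCoeff (μ : Measure ℂ) (n : ℕ) : ℝ :=
  (orthoPoly μ n).leadingCoeff.re

/-- The matrix of the Bergman shift operator (multiplication by `z`) in the basis of orthonormal
polynomials, `M_{j,k} = ⟨z φ_{k-1}, φ_{j-1}⟩ = ∫ conj (φ_{j-1}) z φ_{k-1} dμ`. Rows and columns
are numbered from `1`; the values at `j = 0` or `k = 0` have no meaning. -/
def bergmanShiftMatrix (μ : Measure ℂ) : Matrix ℕ ℕ ℂ := fun j k =>
  ∫ z, conj ((orthoPoly μ (j - 1)).eval z) * (z * (orthoPoly μ (k - 1)).eval z) ∂μ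

/-- `f` is analytic in `{z : R < |z| ≤ ∞}`; at infinity this means that `w ↦ f (1 / w)` extends
analytically across `w = 0`. -/
structure IsAnalyticOutside (R : ℝ) (f : ℂ → ℂ) : Prop where
  analyticOnNhd : AnalyticOnNhd ℂ f {z | R < ‖z‖}
  analytic_at_infinity : ∃ F : ℂ → ℂ, AnalyticAt ℂ F 0 ∧ ∀ᶠ w in 𝓝[≠] (0 : ℂ), F w = f w⁻¹

/-- The orthonormal polynomials have ratio asymptotics `φ_n(z) / φ_{n+1}(z) → f(z)` on
`{z : R < |z|}`, with `f` analytic in `{z : R < |z| ≤ ∞}`. (At `z = ∞` every ratio vanishes, and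
so does `f`.) -/
structure HasRatioAsymptotics (μ : Measure ℂ) (R : ℝ) (f : ℂ → ℂ) : Prop where
  analytic : IsAnalyticOutside R f
  tendsto : ∀ z : ℂ, R < ‖z‖ →
    Tendsto (fun n : ℕ => (orthoPoly μ n).eval z / (orthoPoly μ (n + 1)).eval z) atTop (𝓝 (f z))

/-- `g` is the inverse function of `1 / f` near infinity:
`1 / f (g z) = z = g (1 / f z)` for all `z` of large modulus. -/
def IsInverseNearInfinity (f g : ℂ → ℂ) : Prop :=
  ∃ ρ : ℝ, 0 < ρ ∧ ∀ z : ℂ, ρ < ‖z‖ → 1 / f (g z) = z ∧ g (1 / f z) = z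

/-- `g z = β₋₁ z + β₀ + β₁ / z + β₂ / z² + ⋯` for all `z` of large modulus. The term with index
`k : ℕ` is `β_{k-1} z^{1-k}`. -/
def HasLaurentExpansionAtInfinity (g : ℂ → ℂ) (β : ℤ → ℂ) : Prop :=
  ∃ ρ : ℝ, 0 < ρ ∧ ∀ z : ℂ, ρ < ‖z‖ →
    HasSum (fun k : ℕ => β ((k : ℤ) - 1) * z ^ (1 - (k : ℤ))) (g z)

end

/-!
Expand `z φ_n = ∑ k, A n k * φ_{n+1-k}`, where `A n k = M_{n+2-k, n+1}` is bounded by the radius of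
a centred disc carrying `μ`. For large `|z|` the recurrence forces `φ_n(z)` to grow geometrically in
`n`, so after division by `φ_{n+1}(z)` one may pass to the limit along any filter along which the
sequences `A n` converge, to `a` say: `∑ k, a k * f(z)^k = z f(z)`, i.e. `H ∘ f = z f` near infinity
with `H(u) = ∑ k, a k * u^k`. Here `f → 0` at infinity. If `H(0) = 0`, then `z f(z) = H(f(z)) =
O(f(z))`, which is impossible because `f` does not vanish identically near infinity; so `H(0) ≠ 0`
and `u ↦ u / H(u)` is locally invertible at `0` and sends `f(z)` to `1 / z`; hence `z ↦ z H(1 / z)`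
is the inverse of `1 / f`. Conversely, any inverse `g` of `1 / f` satisfies `u g(1 / u) = z f(z)` at
`u = f(z)`, so its Laurent coefficients are those of `H` by the identity theorem. Thus they are the
only possible limit of the sequences `A n`, which lie in a compact product of discs.
-/

section EssentiallyBoundedMeasure

theorem memLp_of_continuous_of_ae_mem_isCompact {X E : Type*} [TopologicalSpace X]
    [TopologicalSpace.PseudoMetrizableSpace X] [MeasurableSpace X] [OpensMeasurableSpace X]
    [NormedAddCommGroup E] [SecondCountableTopologyEither X E] {μ : Measure X} [IsFiniteMeasure μ]
    {K : Set X} (hK : IsCompact K) (hμ : ∀ᵐ x ∂μ, x ∈ K) {u : X → E} (hu : Continuous u)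
    (p : ENNReal) : MemLp u p μ := by
  obtain ⟨c, hc⟩ := hK.exists_bound_of_continuousOn hu.continuousOn
  exact .of_bound hu.aestronglyMeasurable c (hμ.mono hc)

theorem exists_ae_norm_le_of_isBounded_support {E : Type*} [SeminormedAddCommGroup E]
    [HereditarilyLindelofSpace E] [MeasurableSpace E] {μ : Measure E}
    (h : Bornology.IsBounded μ.support) : ∃ ρ : ℝ, ∀ᵐ z ∂μ, ‖z‖ ≤ ρ :=
  let ⟨ρ, hle⟩ := h.exists_norm_le
  ⟨ρ, Filter.mem_of_superset Measure.support_mem_ae hle⟩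

variable {μ : Measure ℂ} [IsFiniteMeasure μ] {ρ : ℝ}

theorem memLp_eval (hρ : ∀ᵐ z ∂μ, ‖z‖ ≤ ρ) (p : ℂ[X]) : MemLp (fun z => p.eval z) 2 μ :=
  memLp_of_continuous_of_ae_mem_isCompact (isCompact_closedBall 0 ρ)
    (hρ.mono fun _ => mem_closedBall_zero_iff.2) p.continuous 2

/-- The polynomials as elements of `L²(μ)`, for `μ` concentrated on a disc; it turns `polyInner`
into the inner product of a Hilbert space. -/
noncomputable def polyToL2 (hρ : ∀ᵐ z ∂μ, ‖z‖ ≤ ρ) : ℂ[X] →ₗ[ℂ] Lp ℂ 2 μ where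
  toFun p := (memLp_eval hρ p).toLp
  map_add' p q := by simp only [eval_add]; rfl
  map_smul' c p := by simp only [eval_smul]; rfl

variable (hρ : ∀ᵐ z ∂μ, ‖z‖ ≤ ρ)

theorem coeFn_polyToL2 (p : ℂ[X]) : polyToL2 hρ p =ᵐ[μ] fun z => p.eval z :=
  (memLp_eval hρ p).coeFn_toLp

theorem inner_polyToL2 (p q : ℂ[X]) :
    inner ℂ (polyToL2 hρ p) (polyToL2 hρ q) = polyInner μ p q := by
  rw [L2.inner_def]
  refine integral_congr_ae ?_
  filter_upwards [coeFn_polyToL2 hρ p, coeFn_polyToL2 hρ q] with z hp hq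
  rw [hp, hq, RCLike.inner_apply']

theorem norm_polyToL2 (p : ℂ[X]) : ‖polyToL2 hρ p‖ = √(∫ z, ‖p.eval z‖ ^ 2 ∂μ) := by
  have h : polyInner μ p p = ((∫ z, ‖p.eval z‖ ^ 2 ∂μ : ℝ) : ℂ) := by
    rw [polyInner, ← integral_complex_ofReal]
    simp only [Complex.conj_mul', Complex.ofReal_pow]
  rw [norm_eq_sqrt_re_inner (𝕜 := ℂ), inner_polyToL2, h, RCLike.re_eq_complex_re,
    Complex.ofReal_re]

theorem norm_polyToL2_X_mul_le (p : ℂ[X]) : ‖polyToL2 hρ (X * p)‖ ≤ ρ * ‖polyToL2 hρ p‖ := by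
  refine Lp.norm_le_mul_norm_of_ae_le_mul ?_
  filter_upwards [hρ, coeFn_polyToL2 hρ (X * p), coeFn_polyToL2 hρ p] with z hz hXp hp
  rw [hXp, hp, eval_mul, eval_X, norm_mul]
  gcongr

theorem polyToL2_injective (hinf : μ.support.Infinite) : Function.Injective (polyToL2 hρ) := by
  refine (injective_iff_map_eq_zero _).2 fun p hp => ?_
  by_contra hp0
  refine hinf (p.rootSet_finite ℂ |>.subset (Measure.support_subset_of_isClosed
    (p.rootSet_finite ℂ).isClosed ?_))
  filter_upwards [coeFn_polyToL2 hρ p, (Lp.eq_zero_iff_ae_eq_zero).1 hp] with z hz hz0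
  rw [mem_rootSet, coe_aeval_eq_eval]
  exact ⟨hp0, hz ▸ hz0⟩

end EssentiallyBoundedMeasure

section OrthonormalPolynomials

variable {μ : Measure ℂ}

theorem monicOrthoPoly_monic_and_degree_eq (n : ℕ) :
    (monicOrthoPoly μ n).Monic ∧ (monicOrthoPoly μ n).degree = n := by
  induction n using Nat.strong_induction_on with
  | _ n ih =>
    have hdeg : (∑ k : Fin n, C (polyInner μ (monicOrthoPoly μ k) (X ^ n) /
        polyInner μ (monicOrthoPoly μ k) (monicOrthoPoly μ k)) * monicOrthoPoly μ k).degree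
        < (n : WithBot ℕ) := by
      rw [← mem_degreeLT]
      refine Submodule.sum_mem _ fun k _ => ?_
      rw [mem_degreeLT, ← smul_eq_C_mul]
      exact (degree_smul_le _ _).trans_lt ((ih k k.2).2.trans_lt (by exact_mod_cast k.2))
    rw [monicOrthoPoly]
    refine ⟨monic_X_pow_sub hdeg, ?_⟩
    rw [degree_sub_eq_left_of_degree_lt (by rwa [degree_X_pow]), degree_X_pow]

theorem leadingCoeff_orthoPoly (n : ℕ) :
    (orthoPoly μ n).leadingCoeff = (orthoLeadingCoeff μ n : ℂ) := by
  rw [orthoLeadingCoeff, orthoPoly, leadingCoeff_mul, (monicOrthoPoly_monic_and_degree_eq n).1,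
    leadingCoeff_C, mul_one, Complex.ofReal_re]

variable [IsFiniteMeasure μ] {ρ : ℝ} (hρ : ∀ᵐ z ∂μ, ‖z‖ ≤ ρ)

open InnerProductSpace in
theorem polyToL2_monicOrthoPoly (n : ℕ) :
    polyToL2 hρ (monicOrthoPoly μ n) = gramSchmidt ℂ (fun k => polyToL2 hρ (X ^ k)) n := by
  induction n using Nat.strong_induction_on with
  | _ n ih =>
    rw [monicOrthoPoly, gramSchmidt_def, map_sub, map_sum, Nat.Iio_eq_range,
      Finset.sum_range fun k => _]
    congr! 2 with k
    rw [← ih k k.2, Submodule.starProjection_singleton, ← smul_eq_C_mul, map_smul,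
      RCLike.ofReal_pow, ← inner_self_eq_norm_sq_to_K, inner_polyToL2, inner_polyToL2]

theorem polyToL2_orthoPoly (n : ℕ) : polyToL2 hρ (orthoPoly μ n) =
    InnerProductSpace.gramSchmidtNormed ℂ (fun k => polyToL2 hρ (X ^ k)) n := by
  rw [InnerProductSpace.gramSchmidtNormed, ← polyToL2_monicOrthoPoly, norm_polyToL2, orthoPoly,
    ← smul_eq_C_mul, map_smul, Complex.ofReal_inv]
  rfl

variable (hinf : μ.support.Infinite)

include hinf

theorem orthonormal_polyToL2_orthoPoly :
    Orthonormal ℂ fun n => polyToL2 hρ (orthoPoly μ n) := by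
  have hmonomials : LinearIndependent ℂ fun k : ℕ => (X ^ k : ℂ[X]) := by
    simpa only [coe_basisMonomials, ← X_pow_eq_monomial] using
      (basisMonomials ℂ).linearIndependent
  simp only [polyToL2_orthoPoly]
  exact InnerProductSpace.gramSchmidtNormed_orthonormal
    (hmonomials.map' _ (LinearMap.ker_eq_bot.2 (polyToL2_injective hρ hinf)))

include hρ

theorem orthoPoly_ne_zero (n : ℕ) : orthoPoly μ n ≠ 0 := fun h =>
  (orthonormal_polyToL2_orthoPoly hρ hinf).ne_zero n (by rw [h, map_zero])

theorem degree_orthoPoly (n : ℕ) : (orthoPoly μ n).degree = n := by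
  have h := orthoPoly_ne_zero hρ hinf n
  rw [orthoPoly] at h ⊢
  rw [degree_C_mul (C_ne_zero.1 (left_ne_zero_of_mul h)), (monicOrthoPoly_monic_and_degree_eq n).2]

theorem coeff_orthoPoly_self (n : ℕ) :
    (orthoPoly μ n).coeff n = (orthoLeadingCoeff μ n : ℂ) := by
  rw [← leadingCoeff_orthoPoly, leadingCoeff,
    natDegree_eq_of_degree_eq_some (degree_orthoPoly hρ hinf n)]

theorem orthoLeadingCoeff_ne_zero (n : ℕ) : orthoLeadingCoeff μ n ≠ 0 := by
  rw [← Complex.ofReal_ne_zero, ← leadingCoeff_orthoPoly, leadingCoeff_ne_zero]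
  exact orthoPoly_ne_zero hρ hinf n

theorem sum_polyInner_orthoPoly_smul {n : ℕ} {p : ℂ[X]} (hp : p.degree < n) :
    ∑ k ∈ Finset.range n, polyInner μ (orthoPoly μ k) p • orthoPoly μ k = p := by
  let S : Polynomial.Sequence ℂ := ⟨orthoPoly μ, degree_orthoPoly hρ hinf⟩
  have hmem : p ∈ Submodule.span ℂ (S '' (Finset.range n : Set ℕ)) := by
    rwa [Finset.coe_range, S.span_degreeLT fun i _ => (leadingCoeff_ne_zero.2 (S.ne_zero i)).isUnit,
      mem_degreeLT]
  obtain ⟨c, rfl⟩ := (Submodule.mem_span_image_finset_iff_exists_fun' ℂ).1 hmem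
  refine Finset.sum_congr rfl fun k hk => ?_
  rw [← inner_polyToL2 hρ, map_sum]
  simp only [map_smul]
  rw [(orthonormal_polyToL2_orthoPoly hρ hinf).inner_right_sum c hk]

end OrthonormalPolynomials

section BergmanShift

/-- The coefficient of `φ_{n+1-k}` in the orthonormal expansion of `z φ_n`, that is the entry
`M_{n+2-k, n+1}` of the Bergman shift matrix: column `n + 1`, read upwards from the subdiagonal.
For `n + 1 < k` the truncated subtraction makes it the coefficient of `φ_0`. -/
noncomputable def shiftCoeff (μ : Measure ℂ) (n k : ℕ) : ℂ :=
  polyInner μ (orthoPoly μ (n + 1 - k)) (X * orthoPoly μ n)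

theorem bergmanShiftMatrix_eq_shiftCoeff (μ : Measure ℂ) (n k : ℕ) :
    bergmanShiftMatrix μ (((n + 1 : ℕ) : ℤ) - ((k : ℤ) - 1)).toNat (n + 1) = shiftCoeff μ n k := by
  rw [bergmanShiftMatrix, shiftCoeff, polyInner, Nat.add_sub_cancel,
    show (((n + 1 : ℕ) : ℤ) - ((k : ℤ) - 1)).toNat - 1 = n + 1 - k by lia]
  simp only [eval_mul, eval_X]

variable {μ : Measure ℂ} [IsFiniteMeasure μ] {ρ : ℝ} (hρ : ∀ᵐ z ∂μ, ‖z‖ ≤ ρ)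
  (hinf : μ.support.Infinite)

include hρ hinf

theorem norm_shiftCoeff_le (n k : ℕ) : ‖shiftCoeff μ n k‖ ≤ ρ := by
  have h := (orthonormal_polyToL2_orthoPoly hρ hinf).norm_eq_one
  rw [shiftCoeff, ← inner_polyToL2 hρ]
  calc _ ≤ ‖polyToL2 hρ (orthoPoly μ (n + 1 - k))‖ * ‖polyToL2 hρ (X * orthoPoly μ n)‖ :=
        norm_inner_le_norm _ _
    _ ≤ 1 * (ρ * 1) := by
        rw [h, ← h n]
        gcongr
        exact norm_polyToL2_X_mul_le hρ _
    _ = ρ := by ring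

theorem X_mul_orthoPoly_eq_sum (n : ℕ) : X * orthoPoly μ n =
    ∑ k ∈ Finset.range (n + 2), shiftCoeff μ n k • orthoPoly μ (n + 1 - k) := by
  have hdeg : (X * orthoPoly μ n).degree < ((n + 2 : ℕ) : WithBot ℕ) := by
    rw [degree_mul, degree_X, degree_orthoPoly hρ hinf]
    exact_mod_cast (by lia : 1 + n < n + 2)
  rw [← Finset.sum_range_reflect]
  conv_lhs => rw [← sum_polyInner_orthoPoly_smul hρ hinf hdeg]
  refine Finset.sum_congr rfl fun k hk => ?_
  rw [shiftCoeff, show n + 1 - (n + 2 - 1 - k) = k by grind]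

theorem shiftCoeff_zero (n : ℕ) : shiftCoeff μ n 0 =
    ((orthoLeadingCoeff μ n / orthoLeadingCoeff μ (n + 1) : ℝ) : ℂ) := by
  have hlower : ∀ k ∈ Finset.range (n + 1),
      shiftCoeff μ n (k + 1) * (orthoPoly μ (n + 1 - (k + 1))).coeff (n + 1) = 0 := fun k _ => by
    rw [coeff_eq_zero_of_degree_lt, mul_zero]
    rw [degree_orthoPoly hρ hinf]
    exact_mod_cast (by lia : n + 1 - (k + 1) < n + 1)
  have h := congrArg (coeff · (n + 1)) (X_mul_orthoPoly_eq_sum hρ hinf n)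
  simp only [coeff_X_mul, finsetSum_coeff, coeff_smul, smul_eq_mul] at h
  rw [Finset.sum_range_succ', Finset.sum_eq_zero hlower, zero_add, Nat.sub_zero,
    coeff_orthoPoly_self hρ hinf, coeff_orthoPoly_self hρ hinf] at h
  rw [Complex.ofReal_div, h, mul_div_cancel_right₀]
  exact_mod_cast orthoLeadingCoeff_ne_zero hρ hinf (n + 1)

theorem mul_eval_orthoPoly_eq_sum (z : ℂ) (n : ℕ) :
    z * (orthoPoly μ n).eval z = ∑ k ∈ Finset.range (n + 2),
      shiftCoeff μ n k * (orthoPoly μ (n + 1 - k)).eval z := by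
  simpa only [eval_mul, eval_X, eval_finsetSum, eval_smul, smul_eq_mul] using
    congrArg (eval z) (X_mul_orthoPoly_eq_sum hρ hinf n)

theorem eval_orthoPoly_zero_ne_zero (z : ℂ) : (orthoPoly μ 0).eval z ≠ 0 := by
  have h := orthoPoly_ne_zero hρ hinf 0
  rw [eq_C_of_degree_eq_zero (degree_orthoPoly hρ hinf 0)] at h ⊢
  rwa [eval_C, ← C_ne_zero]

end BergmanShift

section HessenbergRecurrence

variable {𝕜 : Type*} [NormedField 𝕜] {A : ℕ → ℕ → 𝕜} {e : ℕ → 𝕜} {z u : 𝕜} {ρ r : ℝ}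

theorem norm_le_mul_norm_succ_of_recurrence {n : ℕ} (hA : ∀ k, ‖A n k‖ ≤ ρ)
    (he : z * e n = ∑ k ∈ Finset.range (n + 2), A n k * e (n + 1 - k))
    (hr0 : 0 < r) (hr1 : r < 1) (hz : ρ < r * (1 - r) * ‖z‖)
    (hdecay : ∀ k ≤ n, ‖e (n - k)‖ ≤ r ^ k * ‖e n‖) : ‖e n‖ ≤ r * ‖e (n + 1)‖ := by
  have hρ : 0 ≤ ρ := (norm_nonneg _).trans (hA 0)
  have hr : 0 < 1 - r := sub_pos.2 hr1
  have hz0 : 0 < ‖z‖ := pos_of_mul_pos_right (hρ.trans_lt hz) (mul_pos hr0 hr).le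
  have hgeom : ∑ k ∈ Finset.range (n + 1), r ^ k ≤ (1 - r)⁻¹ := by
    rw [← tsum_geometric_of_lt_one hr0.le hr1]
    exact (summable_geometric_of_lt_one hr0.le hr1).sum_le_tsum _ fun _ _ => by positivity
  have htail : ‖∑ k ∈ Finset.range (n + 1), A n (k + 1) * e (n + 1 - (k + 1))‖ ≤
      r * ‖z‖ * ‖e n‖ := by
    calc _ ≤ ∑ k ∈ Finset.range (n + 1), ρ * (r ^ k * ‖e n‖) := by
          refine norm_sum_le_of_le _ fun k hk => norm_mul_le_of_le (hA _) ?_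
          rw [Nat.add_sub_add_right]
          exact hdecay k (Finset.mem_range_succ_iff.1 hk)
      _ = ρ * (∑ k ∈ Finset.range (n + 1), r ^ k) * ‖e n‖ := by
          rw [← Finset.mul_sum, ← Finset.sum_mul, mul_assoc]
      _ ≤ r * (1 - r) * ‖z‖ * (1 - r)⁻¹ * ‖e n‖ := by gcongr
      _ = r * ‖z‖ * ‖e n‖ := by field_simp
  have hmain : ‖z‖ * ‖e n‖ ≤ r * ‖z‖ * ‖e n‖ + ρ * ‖e (n + 1)‖ := by
    rw [← norm_mul, he, Finset.sum_range_succ']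
    exact norm_add_le_of_le htail (norm_mul_le_of_le (hA 0) le_rfl)
  refine le_of_mul_le_mul_left ?_ (mul_pos hr hz0)
  calc (1 - r) * ‖z‖ * ‖e n‖ ≤ ρ * ‖e (n + 1)‖ := by linarith
    _ ≤ r * (1 - r) * ‖z‖ * ‖e (n + 1)‖ := by gcongr
    _ = (1 - r) * ‖z‖ * (r * ‖e (n + 1)‖) := by ring

theorem tendsto_div_shift (hne : ∀ n, e n ≠ 0)
    (hlim : Tendsto (fun n => e n / e (n + 1)) atTop (𝓝 u)) (k : ℕ) :
    Tendsto (fun n => e (n + 1 - k) / e (n + 1)) atTop (𝓝 (u ^ k)) := by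
  induction k with
  | zero => simp only [Nat.sub_zero, div_self (hne _), pow_zero, tendsto_const_nhds]
  | succ k ih =>
    rw [pow_succ']
    refine ((hlim.comp (tendsto_sub_atTop_nat k)).mul ih).congr' ?_
    filter_upwards [eventually_ge_atTop k] with n hn
    rw [Function.comp_apply, Nat.add_sub_add_right, ← Nat.sub_add_comm hn,
      div_mul_div_cancel₀ (hne _)]

variable (hA : ∀ n k, ‖A n k‖ ≤ ρ)
  (he : ∀ n, z * e n = ∑ k ∈ Finset.range (n + 2), A n k * e (n + 1 - k))
  (hr0 : 0 < r) (hr1 : r < 1) (hz : ρ < r * (1 - r) * ‖z‖)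

include hA he hr0 hr1 hz

theorem norm_sub_le_pow_mul_norm_of_recurrence (n : ℕ) :
    ∀ k ≤ n, ‖e (n - k)‖ ≤ r ^ k * ‖e n‖ := by
  induction n with
  | zero => simp
  | succ n ih =>
    rintro (_ | k) hk
    · simp
    · rw [Nat.add_sub_add_right]
      calc ‖e (n - k)‖ ≤ r ^ k * ‖e n‖ := ih k (by lia)
        _ ≤ r ^ k * (r * ‖e (n + 1)‖) := by
            gcongr
            exact norm_le_mul_norm_succ_of_recurrence (hA n) (he n) hr0 hr1 hz ih
        _ = r ^ (k + 1) * ‖e (n + 1)‖ := by ring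

variable (he0 : e 0 ≠ 0)

include he0

theorem ne_zero_of_recurrence (n : ℕ) : e n ≠ 0 := fun h => he0 <| by
  simpa [h] using norm_sub_le_pow_mul_norm_of_recurrence hA he hr0 hr1 hz n n le_rfl

theorem norm_div_le_pow_of_recurrence {n k : ℕ} (hk : k ≤ n) : ‖e (n - k) / e n‖ ≤ r ^ k := by
  rw [norm_div, div_le_iff₀ (norm_pos_iff.2 (ne_zero_of_recurrence hA he hr0 hr1 hz he0 n))]
  exact norm_sub_le_pow_mul_norm_of_recurrence hA he hr0 hr1 hz n k hk

variable (hlim : Tendsto (fun n => e n / e (n + 1)) atTop (𝓝 u))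

include hlim

theorem norm_ratio_limit_le_of_recurrence : ‖u‖ ≤ r :=
  le_of_tendsto' hlim.norm fun n => by
    simpa using norm_div_le_pow_of_recurrence hA he hr0 hr1 hz he0 (Nat.le_add_left 1 n)

/- Divide the recurrence by `e (n + 1)`: the quotients `e (n + 1 - k) / e (n + 1)` are dominated by
`r ^ k` and tend to `u ^ k`. -/
theorem hasSum_mul_pow_of_recurrence [CompleteSpace 𝕜] {l : Filter ℕ} [NeBot l] (hl : l ≤ atTop)
    {a : ℕ → 𝕜} (ha : Tendsto A l (𝓝 a)) : HasSum (fun k => a k * u ^ k) (z * u) := by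
  have hne := ne_zero_of_recurrence hA he hr0 hr1 hz he0
  let q (n k : ℕ) : 𝕜 := if k ≤ n + 1 then A n k * (e (n + 1 - k) / e (n + 1)) else 0
  have hq_le (n k : ℕ) : ‖q n k‖ ≤ ρ * r ^ k := by
    by_cases hk : k ≤ n + 1
    · simp only [q, if_pos hk]
      exact norm_mul_le_of_le (hA n k) (norm_div_le_pow_of_recurrence hA he hr0 hr1 hz he0 hk)
    · rw [show q n k = 0 from if_neg hk, norm_zero]
      exact mul_nonneg ((norm_nonneg _).trans (hA 0 0)) (by positivity)
  have hbound : Summable fun k => ρ * r ^ k := (summable_geometric_of_lt_one hr0.le hr1).mul_left ρ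
  have hq_tendsto (k : ℕ) : Tendsto (fun n => q n k) l (𝓝 (a k * u ^ k)) := by
    refine ((tendsto_pi_nhds.1 ha k).mul ((tendsto_div_shift hne hlim k).mono_left hl)).congr' ?_
    filter_upwards [hl (eventually_ge_atTop k)] with n hn
    exact (if_pos (by lia)).symm
  have hq_tsum (n : ℕ) : ∑' k, q n k = z * (e n / e (n + 1)) := by
    rw [mul_div_assoc', he n, Finset.sum_div, tsum_eq_sum (s := Finset.range (n + 2)) fun k hk =>
      if_neg (by grind)]
    refine Finset.sum_congr rfl fun k hk => ?_
    rw [mul_div_assoc]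
    exact if_pos (by grind)
  have hsummable : Summable fun k => a k * u ^ k := .of_norm_bounded hbound fun k =>
    le_of_tendsto' (hq_tendsto k).norm fun n => hq_le n k
  rw [hsummable.hasSum_iff]
  refine tendsto_nhds_unique (tendsto_tsum_of_dominated_convergence hbound hq_tendsto
    (.of_forall hq_le)) ?_
  simpa only [hq_tsum] using (hlim.mono_left hl).const_mul z

end HessenbergRecurrence

section PowerSeries

variable {𝕜 : Type*} [NontriviallyNormedField 𝕜] {a b : ℕ → 𝕜} {h : 𝕜 → 𝕜}

theorem hasSum_mul_zero_pow (a : ℕ → 𝕜) : HasSum (fun k => a k * 0 ^ k) (a 0) := by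
  simpa only [smul_eq_mul, mul_comm] using HasSum.hasSum_at_zero (𝕜 := 𝕜) a

theorem hasFPowerSeriesAt_ofScalars_iff : HasFPowerSeriesAt h (.ofScalars 𝕜 a) 0 ↔
    ∀ᶠ u in 𝓝 0, HasSum (fun k => a k * u ^ k) (h u) := by
  simp only [hasFPowerSeriesAt_iff, FormalMultilinearSeries.coeff_ofScalars, zero_add, smul_eq_mul,
    mul_comm]

theorem hasFPowerSeriesAt_tsum_of_norm_le [CompleteSpace 𝕜] {ρ : ℝ} (ha : ∀ k, ‖a k‖ ≤ ρ) :
    HasFPowerSeriesAt (fun u => ∑' k, a k * u ^ k) (.ofScalars 𝕜 a) 0 := by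
  refine hasFPowerSeriesAt_ofScalars_iff.2 ?_
  filter_upwards [Metric.ball_mem_nhds 0 one_pos] with u hu
  have hgeom := summable_geometric_of_lt_one (norm_nonneg u) (mem_ball_zero_iff.1 hu)
  refine (Summable.of_norm_bounded (hgeom.mul_left ρ) fun k => ?_).hasSum
  rw [norm_mul, norm_pow]
  gcongr
  exact ha k

theorem eq_of_hasFPowerSeriesAt_ofScalars_of_frequently_eq {h' : 𝕜 → 𝕜}
    (ha : HasFPowerSeriesAt h (.ofScalars 𝕜 a) 0) (hb : HasFPowerSeriesAt h' (.ofScalars 𝕜 b) 0)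
    (heq : ∃ᶠ u in 𝓝[≠] 0, h u = h' u) : a = b :=
  FormalMultilinearSeries.ofScalars_series_injective 𝕜 𝕜
    (ha.eq_formalMultilinearSeries_of_eventually hb
      ((ha.analyticAt.frequently_eq_iff_eventually_eq hb.analyticAt).1 heq))

end PowerSeries

section InverseNearInfinity

open Bornology

theorem eventually_cobounded_iff_exists_radius {E : Type*} [SeminormedAddCommGroup E]
    {P : E → Prop} : (∀ᶠ z in cobounded E, P z) ↔ ∃ ρ : ℝ, 0 < ρ ∧ ∀ z, ρ < ‖z‖ → P z := by
  constructor
  · intro h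
    obtain ⟨ρ, -, hρ⟩ := hasBasis_cobounded_norm.eventually_iff.1 h
    exact ⟨max ρ 1, by positivity, fun z hz => hρ ((le_max_left _ _).trans hz.le)⟩
  · rintro ⟨ρ, -, hρ⟩
    exact (tendsto_norm_cobounded_atTop.eventually_gt_atTop ρ).mono hρ

variable {f g : ℂ → ℂ}

theorem isInverseNearInfinity_iff : IsInverseNearInfinity f g ↔
    ∀ᶠ z in cobounded ℂ, 1 / f (g z) = z ∧ g (1 / f z) = z :=
  eventually_cobounded_iff_exists_radius.symm

theorem hasLaurentExpansionAtInfinity_iff {β : ℤ → ℂ} : HasLaurentExpansionAtInfinity g β ↔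
    ∃ h : ℂ → ℂ, HasFPowerSeriesAt h (.ofScalars ℂ fun k : ℕ => β (k - 1)) 0 ∧
      ∀ᶠ z in cobounded ℂ, g z = z * h z⁻¹ := by
  have hterm {z : ℂ} (hz : z ≠ 0) (k : ℕ) : β (k - 1) * z ^ (1 - (k : ℤ)) =
      z * (β (k - 1) * z⁻¹ ^ k) := by
    rw [zpow_sub₀ hz, zpow_one, zpow_natCast, inv_pow]
    ring
  rw [HasLaurentExpansionAtInfinity, ← eventually_cobounded_iff_exists_radius]
  constructor
  · intro hg
    refine ⟨Function.update (fun u => u * g u⁻¹) 0 (β (-1)), ?_, ?_⟩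
    · rw [hasFPowerSeriesAt_ofScalars_iff, ← nhdsNE_sup_pure, eventually_sup, eventually_pure]
      refine ⟨?_, ?_⟩
      · filter_upwards [tendsto_inv₀_nhdsNE_zero.eventually hg, self_mem_nhdsWithin] with u hu hu0
        rw [Function.update_of_ne hu0]
        simpa only [hterm (inv_ne_zero hu0), mul_inv_cancel_left₀ hu0, inv_inv] using hu.mul_left u
      · rw [Function.update_self]
        exact hasSum_mul_zero_pow fun k : ℕ => β (k - 1)
    · filter_upwards [eventually_ne_cobounded 0] with z hz
      rw [Function.update_of_ne (inv_ne_zero hz), inv_inv, mul_inv_cancel_left₀ hz]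
  · rintro ⟨h, hh, hg⟩
    filter_upwards [hg, eventually_ne_cobounded 0, tendsto_inv₀_cobounded.eventually
      (hasFPowerSeriesAt_ofScalars_iff.1 hh)] with z hgz hz hsum
    simpa only [hterm hz, hgz] using hsum.mul_left z

/- `f (K z⁻¹)⁻¹` and `z⁻¹` are both small and have the same image `K z⁻¹` under the locally
injective map `K`. -/
theorem isInverseNearInfinity_of_comp_eq_inv {K : ℂ → ℂ} {K' : ℂ} (hK : HasStrictDerivAt K K' 0)
    (hK' : K' ≠ 0) (hK0 : K 0 = 0) (hf : Tendsto f (cobounded ℂ) (𝓝 0))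
    (hKf : ∀ᶠ z in cobounded ℂ, K (f z) = z⁻¹) : IsInverseNearInfinity f fun z => (K z⁻¹)⁻¹ := by
  have hleft : ∀ᶠ u in 𝓝 0, hK.localInverse K K' 0 hK' (K u) = u := hK.eventually_left_inverse hK'
  have hinv : Tendsto (fun z : ℂ => z⁻¹) (cobounded ℂ) (𝓝[≠] 0) := tendsto_inv₀_cobounded'
  have hg : Tendsto (fun z => (K z⁻¹)⁻¹) (cobounded ℂ) (cobounded ℂ) :=
    tendsto_inv₀_nhdsNE_zero.comp ((hK0 ▸ hK.hasDerivAt.tendsto_nhdsNE hK').comp hinv)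
  refine isInverseNearInfinity_iff.2 ?_
  filter_upwards [hKf, hg.eventually hKf, (hf.comp hg).eventually hleft,
    (hinv.mono_right nhdsWithin_le_nhds).eventually hleft] with z hKfz hKfgz hleft_fg hleft_inv
  have hfg : f (K z⁻¹)⁻¹ = z⁻¹ := by
    rw [Function.comp_apply, hKfgz, inv_inv] at hleft_fg
    exact hleft_fg.symm.trans hleft_inv
  exact ⟨by rw [hfg, one_div, inv_inv], by rw [one_div, inv_inv, hKfz, inv_inv]⟩

variable {H : ℂ → ℂ} (hf : Tendsto f (cobounded ℂ) (𝓝 0))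
  (hHf : ∀ᶠ z in cobounded ℂ, H (f z) = z * f z)

include hf hHf

theorem apply_zero_ne_zero_of_comp_eq_mul (hH : DifferentiableAt ℂ H 0)
    (hf0 : ∃ᶠ z in cobounded ℂ, f z ≠ 0) : H 0 ≠ 0 := fun hH0 => by
  obtain ⟨c, hc⟩ := (hH.isBigO_sub.comp_tendsto hf).bound
  obtain ⟨z, hfz, hcz, hHfz, hz⟩ := (hf0.and_eventually (hc.and (hHf.and
    (tendsto_norm_cobounded_atTop.eventually_gt_atTop c)))).exists
  simp only [Function.comp_apply, hH0, sub_zero, hHfz, norm_mul] at hcz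
  exact hz.not_ge (le_of_mul_le_mul_right hcz (norm_pos_iff.2 hfz))

theorem tendsto_nhdsNE_of_comp_eq_mul (hH : ContinuousAt H 0) (hH0 : H 0 ≠ 0) :
    Tendsto f (cobounded ℂ) (𝓝[≠] 0) := by
  refine tendsto_nhdsWithin_iff.2 ⟨hf, ?_⟩
  filter_upwards [hHf, (hH.tendsto.comp hf).eventually_ne hH0] with z hHfz hne
  rw [Function.comp_apply, hHfz] at hne
  exact right_ne_zero_of_mul hne

theorem isInverseNearInfinity_of_comp_eq_mul (hH : AnalyticAt ℂ H 0) (hH0 : H 0 ≠ 0) :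
    IsInverseNearInfinity f fun z => z * H z⁻¹ := by
  have hK : HasStrictDerivAt (fun u => u / H u) ((1 * H 0 - 0 * deriv H 0) / H 0 ^ 2) 0 :=
    (hasStrictDerivAt_id 0).fun_div hH.hasStrictDerivAt hH0
  have hKf : ∀ᶠ z in cobounded ℂ, f z / H (f z) = z⁻¹ := by
    filter_upwards [hHf, (tendsto_nhdsWithin_iff.1
      (tendsto_nhdsNE_of_comp_eq_mul hf hHf hH.continuousAt hH0)).2] with z hHfz hfz
    rw [hHfz, div_mul_cancel_right₀ hfz]
  convert isInverseNearInfinity_of_comp_eq_inv hK (by simpa using hH0) (zero_div _) hf hKf using 2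
  rw [inv_div, div_inv_eq_mul, mul_comm]

theorem eq_laurentCoeff_of_comp_eq_mul {a : ℕ → ℂ} {β : ℤ → ℂ}
    (hH : HasFPowerSeriesAt H (.ofScalars ℂ a) 0) (hH0 : H 0 ≠ 0)
    (hfg : IsInverseNearInfinity f g) (hg : HasLaurentExpansionAtInfinity g β) (k : ℕ) :
    a k = β (k - 1) := by
  obtain ⟨h, hh, hgh⟩ := hasLaurentExpansionAtInfinity_iff.1 hg
  have hfNE := tendsto_nhdsNE_of_comp_eq_mul hf hHf hH.continuousAt hH0
  refine congrFun (eq_of_hasFPowerSeriesAt_ofScalars_of_frequently_eq hH hh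
    (hfNE.frequently (Eventually.frequently ?_))) k
  filter_upwards [hHf, isInverseNearInfinity_iff.1 hfg, (tendsto_nhdsWithin_iff.1 hfNE).2,
    (tendsto_inv₀_nhdsNE_zero.comp hfNE).eventually hgh] with z hHfz hinv hfz hgz
  rw [Function.comp_apply, ← one_div, hinv.2, one_div, inv_inv] at hgz
  rw [hHfz]
  nth_rw 1 [hgz]
  field_simp [show f z ≠ 0 from hfz]

end InverseNearInfinity

section RatioAsymptotics

open Bornology

theorem eventually_cobounded_lt_mul_norm {E : Type*} [SeminormedAddCommGroup E] (ρ : ℝ) {c : ℝ}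
    (hc : 0 < c) : ∀ᶠ z in cobounded E, ρ < c * ‖z‖ :=
  (tendsto_norm_cobounded_atTop.const_mul_atTop hc).eventually_gt_atTop ρ

theorem exists_pos_eventually_le_of_liminf_pos {ι : Type*} {l : Filter ι} {u : ι → ℝ}
    (h : 0 < liminf u l) : ∃ c > 0, ∀ᶠ i in l, c ≤ u i := by
  rw [liminf_eq] at h
  by_contra hle
  exact h.not_ge (Real.sSup_nonpos fun c hc => not_lt.1 fun hc0 => hle ⟨c, hc0, hc⟩)

variable {μ : Measure ℂ} [IsFiniteMeasure μ] {ρ : ℝ} (hρ : ∀ᵐ z ∂μ, ‖z‖ ≤ ρ)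
  (hinf : μ.support.Infinite)

include hρ hinf

theorem shiftCoeff_mem_pi_closedBall (n : ℕ) :
    shiftCoeff μ n ∈ Set.univ.pi fun _ => Metric.closedBall 0 ρ :=
  fun k _ => mem_closedBall_zero_iff.2 (norm_shiftCoeff_le hρ hinf n k)

theorem exists_mapClusterPt_shiftCoeff : ∃ a, MapClusterPt a atTop (shiftCoeff μ) :=
  let ⟨a, _, ha⟩ := (isCompact_univ_pi fun _ => isCompact_closedBall 0 ρ).exists_mapClusterPt
    (f := atTop) (u := shiftCoeff μ) (tendsto_principal.2 (.of_forall
      (shiftCoeff_mem_pi_closedBall hρ hinf)))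
  ⟨a, ha⟩

theorem tendsto_shiftCoeff_of_unique_mapClusterPt {b : ℕ → ℂ}
    (h : ∀ a, MapClusterPt a atTop (shiftCoeff μ) → a = b) :
    Tendsto (shiftCoeff μ) atTop (𝓝 b) :=
  (isCompact_univ_pi fun _ => isCompact_closedBall 0 ρ).tendsto_nhds_of_unique_mapClusterPt
    (.of_forall (shiftCoeff_mem_pi_closedBall hρ hinf)) fun a _ => h a

variable {f : ℂ → ℂ} (hf : ∀ᶠ z in cobounded ℂ,
  Tendsto (fun n => (orthoPoly μ n).eval z / (orthoPoly μ (n + 1)).eval z) atTop (𝓝 (f z)))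

include hf

theorem tendsto_ratioLimit_cobounded : Tendsto f (cobounded ℂ) (𝓝 0) := by
  have hle {r : ℝ} (hr0 : 0 < r) (hr1 : r < 1) : ∀ᶠ z in cobounded ℂ, ‖f z‖ ≤ r := by
    filter_upwards [hf, eventually_cobounded_lt_mul_norm ρ (mul_pos hr0 (sub_pos.2 hr1))]
      with z hfz hz
    exact norm_ratio_limit_le_of_recurrence (norm_shiftCoeff_le hρ hinf)
      (mul_eval_orthoPoly_eq_sum hρ hinf z) hr0 hr1 hz (eval_orthoPoly_zero_ne_zero hρ hinf z) hfz
  refine NormedAddGroup.tendsto_nhds_zero.2 fun ε hε => ?_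
  filter_upwards [hle (lt_min (half_pos hε) one_half_pos)
    ((min_le_right _ _).trans_lt one_half_lt_one)] with z hz
  exact (hz.trans (min_le_left _ _)).trans_lt (half_lt_self hε)

theorem hasSum_mul_ratioLimit_pow {a : ℕ → ℂ} (ha : MapClusterPt a atTop (shiftCoeff μ)) :
    ∀ᶠ z in cobounded ℂ, HasSum (fun k => a k * f z ^ k) (z * f z) := by
  obtain ⟨U, hU, haU⟩ := mapClusterPt_iff_ultrafilter.1 ha
  filter_upwards [hf, eventually_cobounded_lt_mul_norm ρ
    (mul_pos one_half_pos (sub_pos.2 one_half_lt_one))] with z hfz hz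
  exact hasSum_mul_pow_of_recurrence (norm_shiftCoeff_le hρ hinf)
    (mul_eval_orthoPoly_eq_sum hρ hinf z) one_half_pos one_half_lt_one hz
    (eval_orthoPoly_zero_ne_zero hρ hinf z) hfz hU haU

theorem exists_hasFPowerSeriesAt_comp_ratioLimit_eq_mul {a : ℕ → ℂ}
    (ha : MapClusterPt a atTop (shiftCoeff μ)) (hf0 : ∃ᶠ z in cobounded ℂ, f z ≠ 0) :
    ∃ H : ℂ → ℂ, HasFPowerSeriesAt H (.ofScalars ℂ a) 0 ∧ H 0 ≠ 0 ∧
      ∀ᶠ z in cobounded ℂ, H (f z) = z * f z := by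
  obtain ⟨U, -, haU⟩ := mapClusterPt_iff_ultrafilter.1 ha
  have hH := hasFPowerSeriesAt_tsum_of_norm_le fun k =>
    le_of_tendsto' (tendsto_pi_nhds.1 haU k).norm fun n => norm_shiftCoeff_le hρ hinf n k
  have hHf := (hasSum_mul_ratioLimit_pow hρ hinf hf ha).mono fun _ h => h.tsum_eq
  exact ⟨_, hH, apply_zero_ne_zero_of_comp_eq_mul (tendsto_ratioLimit_cobounded hρ hinf hf) hHf
    hH.differentiableAt hf0, hHf⟩

theorem frequently_ratioLimit_ne_zero
    (hκ : 0 < liminf (fun n => orthoLeadingCoeff μ n / orthoLeadingCoeff μ (n + 1)) atTop) :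
    ∃ᶠ z in cobounded ℂ, f z ≠ 0 := by
  obtain ⟨c, hc, hcκ⟩ := exists_pos_eventually_le_of_liminf_pos hκ
  obtain ⟨a, ha⟩ := exists_mapClusterPt_shiftCoeff hρ hinf
  obtain ⟨U, hU, haU⟩ := mapClusterPt_iff_ultrafilter.1 ha
  have ha0 : a 0 ≠ 0 := by
    refine norm_pos_iff.1 (hc.trans_le (ge_of_tendsto (tendsto_pi_nhds.1 haU 0).norm ?_))
    filter_upwards [hU hcκ] with n hn
    rw [shiftCoeff_zero hρ hinf, Complex.norm_real]
    exact hn.trans (le_abs_self _)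
  refine Eventually.frequently ?_
  filter_upwards [hasSum_mul_ratioLimit_pow hρ hinf hf ha] with z hsum hfz
  rw [hfz, mul_zero] at hsum
  exact ha0 ((hasSum_mul_zero_pow a).unique hsum)

end RatioAsymptotics

theorem theorem1p6_general (μ : Measure ℂ) [IsFiniteMeasure μ]
    (hbdd : Bornology.IsBounded μ.support) (hinf : μ.support.Infinite) (f : ℂ → ℂ)
    (hf : ∀ᶠ z in Bornology.cobounded ℂ, Tendsto
      (fun n : ℕ => (orthoPoly μ n).eval z / (orthoPoly μ (n + 1)).eval z) atTop (𝓝 (f z)))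
    (hf0 : ∃ᶠ z in Bornology.cobounded ℂ, f z ≠ 0) :
    (∃ (g : ℂ → ℂ) (β : ℤ → ℂ),
      IsInverseNearInfinity f g ∧ HasLaurentExpansionAtInfinity g β) ∧
    ∀ (g : ℂ → ℂ) (β : ℤ → ℂ),
      IsInverseNearInfinity f g → HasLaurentExpansionAtInfinity g β →
      ∀ j : ℤ, -1 ≤ j →
        Tendsto (fun n : ℕ => bergmanShiftMatrix μ ((n : ℤ) - j).toNat n) atTop (𝓝 (β j)) := by
  obtain ⟨ρ, hρ⟩ := exists_ae_norm_le_of_isBounded_support hbdd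
  have hf_lim := tendsto_ratioLimit_cobounded hρ hinf hf
  refine ⟨?_, fun g β hfg hg j hj => ?_⟩
  · obtain ⟨a, ha⟩ := exists_mapClusterPt_shiftCoeff hρ hinf
    obtain ⟨H, hH, hH0, hHf⟩ :=
      exists_hasFPowerSeriesAt_comp_ratioLimit_eq_mul hρ hinf hf ha hf0
    refine ⟨fun z => z * H z⁻¹, fun j => a (j + 1).toNat,
      isInverseNearInfinity_of_comp_eq_mul hf_lim hHf hH.analyticAt hH0,
      hasLaurentExpansionAtInfinity_iff.2 ⟨H, ?_, .of_forall fun _ => rfl⟩⟩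
    simpa only [sub_add_cancel, Int.toNat_natCast] using hH
  · have hlim : Tendsto (shiftCoeff μ) atTop (𝓝 fun k : ℕ => β (k - 1)) :=
      tendsto_shiftCoeff_of_unique_mapClusterPt hρ hinf fun a ha => by
        obtain ⟨H, hH, hH0, hHf⟩ :=
          exists_hasFPowerSeriesAt_comp_ratioLimit_eq_mul hρ hinf hf ha hf0
        exact funext (eq_laurentCoeff_of_comp_eq_mul hf_lim hHf hH hH0 hfg hg)
    obtain ⟨k, rfl⟩ : ∃ k : ℕ, j = k - 1 := ⟨(j + 1).toNat, by lia⟩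
    rw [← tendsto_add_atTop_iff_nat 1]
    simpa only [bergmanShiftMatrix_eq_shiftCoeff] using tendsto_pi_nhds.1 hlim k

theorem theorem1p6 (μ : Measure ℂ) [IsFiniteMeasure μ]
    (hbdd : Bornology.IsBounded μ.support) (hinf : μ.support.Infinite)
    (R : ℝ) (hR : 0 < R) (f : ℂ → ℂ) (hf : HasRatioAsymptotics μ R f)
    (hκ : 0 < liminf (fun n : ℕ => orthoLeadingCoeff μ n / orthoLeadingCoeff μ (n + 1)) atTop) :
    (∃ (g : ℂ → ℂ) (β : ℤ → ℂ),
      IsInverseNearInfinity f g ∧ HasLaurentExpansionAtInfinity g β) ∧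
    ∀ (g : ℂ → ℂ) (β : ℤ → ℂ),
      IsInverseNearInfinity f g → HasLaurentExpansionAtInfinity g β →
      ∀ j : ℤ, -1 ≤ j →
        Tendsto (fun n : ℕ => bergmanShiftMatrix μ ((n : ℤ) - j).toNat n) atTop (𝓝 (β j)) := by
  have hf_tendsto := (tendsto_norm_cobounded_atTop.eventually_gt_atTop R).mono hf.tendsto
  obtain ⟨ρ, hρ⟩ := exists_ae_norm_le_of_isBounded_support hbdd
  exact theorem1p6_general μ hbdd hinf f hf_tendsto
    (frequently_ratioLimit_ne_zero hρ hinf hf_tendsto hκ)
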